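/- Let $G$ be a discrete group, let $A$ and $B$ be commutative unital $C^*$-algebras, and let $\alpha\colon G\to\mathrm{Aut}(A)$ and $\beta\colon G\to\mathrm{Aut}(B)$ be actions by $*$-automorphisms, giving untwisted unital discrete $C^*$-dynamical systems $\Sigma=(A,G,\alpha)$ and $\Theta=(B,G,\beta)$. The systems are called conjugate if there is a $*$-isomorphism $\phi\colon A\to B$ with $\beta_g=\phi\circ\alpha_g\circ\phi^{-1}$ for all $g\in G$. They are called Morita equivalent if there are an $A$-$B$ imprimitivity bimodule $Z$ and a map $\delta$ from $G$ to the invertible bounded $\mathbb C$-linear maps of $Z$ such that $\delta(g)(a\cdot z)=\alpha_g(a)\cdot\delta(g)z$, $\delta(g)(z\cdot b)=(\delta(g)z)\cdot\beta_g(b)$, $\delta(g)\delta(h)z=\delta(gh)z$ and $\langle\delta(g)z,\delta(g)\zeta\rangle_B=\beta_g(\langle z,\zeta\rangle_B)$ for all $g,h\in G$, $a\in A$, $b\in B$, $z,\zeta\in Z$. An equivariant representation $(\rho,v)$ of $\Sigma$ on a right Hilbert $A$-module $X$ consists of a unital $*$-homomorphism $\rho$ from $A$ to the adjointable operators on $X$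 and a map $v$ from $G$ to the invertible bounded $\mathbb C$-linear maps of $X$ with $\rho(\alpha_g(a))=v(g)\rho(a)v(g)^{-1}$, $v(g)v(h)=v(gh)$, $\alpha_g(\langle x,y\rangle)=\langle v(g)x,v(g)y\rangle$ and $v(g)(x\cdot a)=(v(g)x)\cdot\alpha_g(a)$ for all $g,h\in G$, $a\in A$, $x,y\in X$. The Fourier–Stieltjes algebra $B(\Sigma)$ is the set of all maps $T_{\rho,v,x,y}\colon G\times A\to A$, $(g,a)\mapsto\langle x,\rho(a)v(g)y\rangle$, where $(\rho,v)$ is an equivariant representation of $\Sigma$ on some $X$ and $x,y\in X$. It is a unital algebra with pointwise vector space operations and the product $(T\cdot T')(g,a)=T(g,T'(g,a))$, normed by $\|T\|=\inf\{\|x\|\,\|y\| : T=T_{\rho,v,x,y}\}$; $B(\Theta)$ is defined likewise. Then $\Sigma$ and $\Theta$ are Morita equivalent if and only if they are conjugate. Moreover, in that case $B(\Sigma)$ and $B(\Theta)$ are isometrically isomorphic: there is an isomorphism of unital algebras $\Psi\colon B(\Sigma)\to B(\Theta)$ with $\|\Psi(T)\|=\|T\|$ for all $T\in B(\Sigma)$.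 -/

import Mathlib

open scoped RightActions InnerProductSpace

universe u v w

/-! ### Twisted unital discrete C*-dynamical systems -/

/-- A twisted unital discrete C*-dynamical system `(A, G, α, σ)`: `A` is a unital C*-algebra, `G` a
(discrete) group, and `(α, σ)` a twisted action of `G` on `A`. -/
structure TwistedSystem (G : Type v) [Group G] (A : Type u) [CStarAlgebra A] where
  /-- the map `α : G → Aut(A)` -/
  α : G → (A ≃⋆ₐ[ℂ] A)
  /-- the normalized 2-cocycle `σ : G × G → 𝒰(A)` -/
  σ : G → G → unitary A
  α_α : ∀ g h a, α g (α h a) = (σ g h : A) * α (g * h) a * star (σ g h : A)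
  cocycle : ∀ g h k, (σ g h : A) * σ (g * h) k = α g (σ h k) * σ g (h * k)
  σ_one_right : ∀ g, σ g 1 = 1
  σ_one_left : ∀ g, σ 1 g = 1

/-- The untwisted system `(A, G, α)` of a genuine action `α : G → Aut(A)`, i.e. `σ = 1`. -/
def TwistedSystem.ofAction {G : Type v} [Group G] {A : Type u} [CStarAlgebra A]
    (α : G →* (A ≃⋆ₐ[ℂ] A)) : TwistedSystem G A where
  α := α
  σ := fun _ _ => 1
  α_α := fun g h a => by simp
  cocycle := fun g h k => by simp
  σ_one_right := fun _ => rfl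
  σ_one_left := fun _ => rfl

/-- Conjugacy of two systems over the same group: an isomorphism `φ : A → B` of C*-algebras with
`β_g = φ ∘ α_g ∘ φ⁻¹` and `θ(g, h) = φ(σ(g, h))`. -/
def TwistedSystem.Conjugate {G : Type v} [Group G] {A : Type u} {B : Type w} [CStarAlgebra A]
    [CStarAlgebra B] (S : TwistedSystem G A) (T : TwistedSystem G B) : Prop :=
  ∃ φ : A ≃⋆ₐ[ℂ] B, (∀ g b, T.α g b = φ (S.α g (φ.symm b))) ∧
    ∀ g h, (T.σ g h : B) = φ (S.σ g h : A)

/-! ### Hilbert C*-modules and bimodules -/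

/-- A (right) Hilbert module `X` over the unital C*-algebra `B`; `x <• b` is the right action. The
`B`-valued inner product `⟪x, y⟫_B` is linear in the second variable, positivity of an element of
`B` is expressed as being of the form `b⋆ b`, and `X` is complete for the norm
`‖x‖ = ‖⟪x, x⟫_B‖ ^ (1/2)`. (Mathlib's `CStarModule` is about left actions.) -/
class RightHilbertModule (B : Type u) [CStarAlgebra B] (X : Type v) [NormedAddCommGroup X]
    [NormedSpace ℂ X] [Module Bᵐᵒᵖ X] extends Inner B X where
  inner_add_right : ∀ x y z : X, ⟪x, y + z⟫_B = ⟪x, y⟫_B + ⟪x, z⟫_B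
  inner_smul_right : ∀ (x y : X) (c : ℂ), ⟪x, c • y⟫_B = c • ⟪x, y⟫_B
  inner_op_smul_right : ∀ (x y : X) (b : B), ⟪x, y <• b⟫_B = ⟪x, y⟫_B * b
  star_inner : ∀ x y : X, star ⟪x, y⟫_B = ⟪y, x⟫_B
  inner_self_nonneg : ∀ x : X, ∃ b : B, ⟪x, x⟫_B = star b * b
  norm_sq_eq : ∀ x : X, ‖x‖ ^ 2 = ‖⟪x, x⟫_B‖
  complete : CompleteSpace X

/-- A representation of `A` on the Hilbert `B`-module `X`, i.e. a unital *-homomorphism from `A` to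
the adjointable operators on `X`. It makes `X` a right Hilbert `A`-`B` bimodule, with
`a · x = κ(a) x`. (`B`-linearity of each `κ(a)` follows from `adjoint`.) -/
structure HilbertRep (A : Type u) (B : Type v) (X : Type w) [CStarAlgebra A] [CStarAlgebra B]
    [NormedAddCommGroup X] [NormedSpace ℂ X] [Module Bᵐᵒᵖ X] [RightHilbertModule B X] where
  act : A →ₐ[ℂ] (X →L[ℂ] X)
  adjoint : ∀ (a : A) (x y : X), ⟪act a x, y⟫_B = ⟪x, act (star a) y⟫_B

/-- The structure of an `A`-`B` imprimitivity bimodule on the right Hilbert `B`-module `Z`: a left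
action of `A` making `Z` a full right Hilbert `A`-`B` bimodule and an `A`-valued inner product
(linear in the first variable) making `Z` a full left Hilbert `A`-`B` bimodule, with
`_A⟨z, z'⟩ · z'' = z · ⟨z', z''⟩_B`. (It follows that the norm of the left inner product equals
that of the right one, so that `Z` is complete for it as well.) -/
structure ImprimitivityBimodule (A : Type u) (B : Type v) (Z : Type w) [CStarAlgebra A]
    [CStarAlgebra B] [NormedAddCommGroup Z] [NormedSpace ℂ Z] [Module Bᵐᵒᵖ Z]
    [RightHilbertModule B Z] extends HilbertRep A B Z where
  leftInner : Z → Z → A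
  leftInner_add_left : ∀ x y z, leftInner (x + y) z = leftInner x z + leftInner y z
  leftInner_smul_left : ∀ (c : ℂ) (x y), leftInner (c • x) y = c • leftInner x y
  leftInner_act_left : ∀ (a : A) (x y), leftInner (act a x) y = a * leftInner x y
  star_leftInner : ∀ x y, star (leftInner x y) = leftInner y x
  leftInner_self_nonneg : ∀ x, ∃ a : A, leftInner x x = star a * a
  leftInner_definite : ∀ x, leftInner x x = 0 → x = 0
  leftInner_op_smul : ∀ (x y) (b : B), leftInner (x <• b) y = leftInner x (y <• star b)
  leftInner_act : ∀ x y z : Z, act (leftInner x y) z = x <• ⟪y, z⟫_B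
  full_right : (Submodule.span ℂ {b : B | ∃ x y : Z, ⟪x, y⟫_B = b}).topologicalClosure = ⊤
  full_left : (Submodule.span ℂ {a : A | ∃ x y : Z, leftInner x y = a}).topologicalClosure = ⊤

/-! ### Morita equivalence of systems -/

/-- A `(Σ, Θ)`-compatible action `δ` of `G` on the right Hilbert `A`-`B` bimodule `Z`, where
`Σ = (A, G, α, σ)` and `Θ = (B, G, β, θ)`. -/
structure CompatibleAction {G : Type*} [Group G] {A B Z : Type*} [CStarAlgebra A] [CStarAlgebra B]
    [NormedAddCommGroup Z] [NormedSpace ℂ Z] [Module Bᵐᵒᵖ Z] [RightHilbertModule B Z]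
    (S : TwistedSystem G A) (T : TwistedSystem G B) (κ : HilbertRep A B Z) where
  δ : G → (Z ≃L[ℂ] Z)
  δ_act : ∀ g a z, δ g (κ.act a z) = κ.act (S.α g a) (δ g z)
  δ_op_smul : ∀ g z (b : B), δ g (z <• b) = δ g z <• T.α g b
  δ_δ : ∀ g h z, δ g (δ h z) = κ.act (S.σ g h : A) (δ (g * h) z) <• star (T.σ g h : B)
  inner_δ : ∀ g x y, ⟪δ g x, δ g y⟫_B = T.α g ⟪x, y⟫_B

/-- Morita equivalence of two systems over the same group. -/
def TwistedSystem.MoritaEquivalent {G : Type w} [Group G] {A : Type u} {B : Type v}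
    [CStarAlgebra A] [CStarAlgebra B] (S : TwistedSystem G A) (T : TwistedSystem G B) : Prop :=
  ∃ (Z : Type (max u v)) (_ : NormedAddCommGroup Z) (_ : NormedSpace ℂ Z) (_ : Module Bᵐᵒᵖ Z)
    (_ : RightHilbertModule B Z) (I : ImprimitivityBimodule A B Z),
    Nonempty (CompatibleAction S T I.toHilbertRep)

/-! ### Equivariant representations and the Fourier-Stieltjes algebra -/

/-- An equivariant representation `(ρ, v)` of `Σ = (A, G, α, σ)` on the Hilbert `A`-module `X`. -/
structure EquivariantRep {G : Type*} [Group G] {A : Type*} [CStarAlgebra A]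
    (S : TwistedSystem G A) (X : Type*) [NormedAddCommGroup X] [NormedSpace ℂ X] [Module Aᵐᵒᵖ X]
    [RightHilbertModule A X] where
  ρ : HilbertRep A A X
  v : G → (X ≃L[ℂ] X)
  ρ_α : ∀ g a x, ρ.act (S.α g a) x = v g (ρ.act a ((v g).symm x))
  v_v : ∀ g h x, v g (v h x) = ρ.act (S.σ g h : A) (v (g * h) x) <• star (S.σ g h : A)
  inner_v : ∀ g x y, S.α g ⟪x, y⟫_A = ⟪v g x, v g y⟫_A
  v_op_smul : ∀ g x (a : A), v g (x <• a) = v g x <• S.α g a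

/-- The algebra `L(Σ)` of maps `G × A → A` that are linear in the second variable, with pointwise
vector space operations, product `(T T')(g, a) = T(g, T'(g, a))` and unit `(g, a) ↦ a`. -/
abbrev LAlg (G : Type v) (A : Type u) [CStarAlgebra A] : Type (max u v) := G → Module.End ℂ A

/-- The coefficient function `T_{ρ,v,x,y}(g, a) = ⟨x, ρ(a) v(g) y⟩` of `(ρ, v)`. -/
def EquivariantRep.coeff {G : Type v} [Group G] {A : Type u} [CStarAlgebra A]
    {S : TwistedSystem G A} {X : Type*} [NormedAddCommGroup X] [NormedSpace ℂ X] [Module Aᵐᵒᵖ X]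
    [RightHilbertModule A X] (π : EquivariantRep S X) (x y : X) : LAlg G A := fun g =>
  { toFun := fun a => ⟪x, π.ρ.act a (π.v g y)⟫_A
    map_add' := fun a b => by simp [RightHilbertModule.inner_add_right]
    map_smul' := fun c a => by simp [RightHilbertModule.inner_smul_right] }

/-- `T = T_{ρ,v,x,y}` for an equivariant representation `(ρ, v)` of `Σ` on a Hilbert `A`-module `X`
and `x, y ∈ X` with `‖x‖ ‖y‖ = r`. -/
def TwistedSystem.HasDecomposition {G : Type v} [Group G] {A : Type u} [CStarAlgebra A]
    (S : TwistedSystem G A) (T : LAlg G A) (r : ℝ) : Prop :=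
  ∃ (X : Type (max u v)) (_ : NormedAddCommGroup X) (_ : NormedSpace ℂ X) (_ : Module Aᵐᵒᵖ X)
    (_ : RightHilbertModule A X) (π : EquivariantRep S X) (x y : X),
    T = π.coeff x y ∧ r = ‖x‖ * ‖y‖

/-! ### `B(Σ)` is a subalgebra of `L(Σ)`

An algebraic version of an equivariant representation, on a space with a semidefinite inner product,
yields one on a Hilbert module by completion. -/

namespace TwistedSystem

/-- A self-adjoint `M` is of the form `C⋆ C` as soon as its negative part `N` vanishes. -/
lemma exists_negPart {D : Type*} [CStarAlgebra D] (M : D) (hsa : star M = M) :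
    ∃ E N : D, star N = N ∧ N = star E * E ∧ N * M * N = -(N * N * N) ∧
      (N = 0 → ∃ C, M = star C * C) := by
  let _ := CStarAlgebra.spectralOrder D
  have := CStarAlgebra.spectralOrderedRing D
  have hsa : IsSelfAdjoint M := hsa
  obtain ⟨E, hE⟩ := CStarAlgebra.nonneg_iff_eq_star_mul_self.mp (CFC.negPart_nonneg M)
  refine ⟨E, M⁻, (CFC.negPart_nonneg M).isSelfAdjoint.star_eq, hE, ?_, fun h => ?_⟩
  · have h := CFC.posPart_sub_negPart M hsa
    have h0 : M⁺ * M⁻ = 0 := CFC.posPart_mul_negPart M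
    calc M⁻ * M * M⁻ = M⁻ * (M⁺ - M⁻) * M⁻ := by rw [h]
      _ = M⁻ * (M⁺ * M⁻) - M⁻ * M⁻ * M⁻ := by noncomm_ring
      _ = _ := by rw [h0]; simp
  · exact CStarAlgebra.nonneg_iff_eq_star_mul_self.mp ((CFC.negPart_eq_zero_iff M hsa).mp h)

/-- A matrix over a C*-algebra whose quadratic form is positive is of the form `C⋆ C`. -/
lemma exists_matrix_factorization {A : Type*} [CStarAlgebra A] [PartialOrder A] [StarOrderedRing A]
    {n : Type*} [Fintype n] [DecidableEq n] (M : n → n → A) (hM : ∀ i j, star (M i j) = M j i)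
    (hpos : ∀ c : n → A, 0 ≤ ∑ i, ∑ j, star (c i) * M i j * c j) :
    ∃ C : n → n → A, ∀ i j, M i j = ∑ k, star (C k i) * C k j := by
  let M' : CStarMatrix n n A := CStarMatrix.ofMatrix (Matrix.of M)
  have hentry : ∀ i j, M' i j = M i j := fun _ _ => rfl
  have hsa : star M' = M' := by
    ext i j
    simp [CStarMatrix.star_apply, hentry, hM]
  obtain ⟨E, N, hNsa, hE, h1, hfac⟩ := exists_negPart M' hsa
  have h2 : N * N * N = star (E * N) * (E * N) := by
    rw [star_mul, hNsa]
    conv_lhs => rw [mul_assoc]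
    nth_rewrite 2 [hE]
    noncomm_ring
  have h3 : ∀ k, 0 ≤ (N * M' * N) k k := by
    intro k
    have := hpos (fun i => N i k)
    convert this using 1
    simp only [CStarMatrix.mul_apply, Finset.sum_mul]
    rw [Finset.sum_comm]
    refine Finset.sum_congr rfl fun i _ => Finset.sum_congr rfl fun j _ => ?_
    rw [← hNsa, CStarMatrix.star_apply, hNsa, hentry]
  have h4 : ∀ k i, (E * N) i k = 0 := by
    intro k
    have h5 : (N * N * N) k k = ∑ i, star ((E * N) i k) * (E * N) i k := by
      rw [h2, CStarMatrix.mul_apply]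
      simp [CStarMatrix.star_apply]
    have h6 : ∑ i, star ((E * N) i k) * (E * N) i k ≤ 0 := by
      rw [← h5]
      have := h3 k
      rw [h1] at this
      simpa using this
    have h7 := le_antisymm h6 (Finset.sum_nonneg fun i _ => star_mul_self_nonneg _)
    rw [Finset.sum_eq_zero_iff_of_nonneg (fun i _ => star_mul_self_nonneg _)] at h7
    intro i
    have := h7 i (Finset.mem_univ i)
    rwa [CStarRing.star_mul_self_eq_zero_iff] at this
  have h8 : N = 0 := by
    have h9 : E * N = 0 := by ext i k; simpa using h4 k i
    have h10 : star N * N = 0 := by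
      rw [hNsa]
      nth_rewrite 1 [hE]
      rw [mul_assoc, h9, mul_zero]
    rwa [CStarRing.star_mul_self_eq_zero_iff] at h10
  obtain ⟨C, hC⟩ := hfac h8
  refine ⟨fun i j => C i j, fun i j => ?_⟩
  rw [← hentry, hC, CStarMatrix.mul_apply]
  simp [CStarMatrix.star_apply]

/-- An algebraic equivariant representation of `Σ` on a space with a semidefinite `A`-valued inner
product. -/
structure PreRep {G : Type*} [Group G] {A : Type*} [CStarAlgebra A] (S : TwistedSystem G A)
    (E : Type*) [AddCommGroup E] [Module ℂ E] [Module Aᵐᵒᵖ E] where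
  ip : E → E → A
  ip_add : ∀ x y z, ip x (y + z) = ip x y + ip x z
  ip_smul : ∀ x y (c : ℂ), ip x (c • y) = c • ip x y
  ip_op : ∀ x y (a : A), ip x (y <• a) = ip x y * a
  star_ip : ∀ x y, star (ip x y) = ip y x
  ip_nonneg : ∀ x, ∃ b, ip x x = star b * b
  ρ : A →ₐ[ℂ] Module.End ℂ E
  ρ_adj : ∀ a x y, ip (ρ a x) y = ip x (ρ (star a) y)
  v : G → (E ≃ₗ[ℂ] E)
  v_ρ : ∀ g a x, v g (ρ a x) = ρ (S.α g a) (v g x)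
  v_op : ∀ g x (a : A), v g (x <• a) = v g x <• S.α g a
  ip_v : ∀ g x y, ip (v g x) (v g y) = S.α g (ip x y)
  v_v : ∀ g h x z, ip z (v g (v h x)) = ip z (ρ (S.σ g h : A) (v (g * h) x) <• star (S.σ g h : A))

namespace PreRep

variable {G : Type*} [Group G] {A : Type*} [CStarAlgebra A] {S : TwistedSystem G A}
  {E : Type*} [AddCommGroup E] [Module ℂ E] [Module Aᵐᵒᵖ E] (P : PreRep S E)

lemma ip_zero (x : E) : P.ip x 0 = 0 := by
  have := P.ip_smul x 0 0
  simpa using this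

lemma ip_neg (x y : E) : P.ip x (-y) = -P.ip x y := by
  have := P.ip_smul x y (-1)
  simpa using this

lemma ip_sub (x y z : E) : P.ip x (y - z) = P.ip x y - P.ip x z := by
  rw [sub_eq_add_neg, P.ip_add, P.ip_neg, sub_eq_add_neg]

lemma ip_add_left (x y z : E) : P.ip (x + y) z = P.ip x z + P.ip y z := by
  rw [← P.star_ip, P.ip_add, star_add, P.star_ip, P.star_ip]

lemma ip_sub_left (x y z : E) : P.ip (x - y) z = P.ip x z - P.ip y z := by
  rw [← P.star_ip, P.ip_sub, star_sub, P.star_ip, P.star_ip]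

lemma ip_smul_left (x y : E) (c : ℂ) : P.ip (c • x) y = star c • P.ip x y := by
  rw [← P.star_ip, P.ip_smul, star_smul, P.star_ip]

lemma ip_op_left (x y : E) (a : A) : P.ip (x <• a) y = star a * P.ip x y := by
  rw [← P.star_ip, P.ip_op, star_mul, P.star_ip]

/-- The seminorm of a semidefinite inner product. -/
noncomputable def nrm (x : E) : ℝ := √‖P.ip x x‖

lemma nrm_sq (x : E) : P.nrm x ^ 2 = ‖P.ip x x‖ := Real.sq_sqrt (norm_nonneg _)

lemma nrm_nonneg (x : E) : 0 ≤ P.nrm x := Real.sqrt_nonneg _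

lemma norm_ip_le (x y : E) : ‖P.ip x y‖ ≤ P.nrm x * P.nrm y := by
  let _ := CStarAlgebra.spectralOrder A
  have := CStarAlgebra.spectralOrderedRing A
  have key : ∀ N : ℝ, ‖P.ip x x‖ < N → ‖P.ip x y‖ ^ 2 ≤ N * ‖P.ip y y‖ := by
    intro N hN
    have hN0 : 0 < N := (norm_nonneg _).trans_lt hN
    set c := P.ip x y with hc
    set z := x <• c - (N : ℂ) • y with hz
    have h0 : 0 ≤ P.ip z z := CStarAlgebra.nonneg_iff_eq_star_mul_self.mpr (P.ip_nonneg z)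
    have hyx : P.ip y x = star c := by rw [hc, P.star_ip]
    have h1 : P.ip z z = star c * P.ip x x * c - (N : ℂ) • (star c * c) - (N : ℂ) • (star c * c)
        + (N : ℂ) • ((N : ℂ) • P.ip y y) := by
      simp only [hz, P.ip_sub, P.ip_sub_left, P.ip_op, P.ip_op_left, P.ip_smul, P.ip_smul_left,
        ← hc, hyx, RCLike.star_def, Complex.conj_ofReal, mul_assoc, smul_mul_assoc,
        mul_smul_comm]
      abel
    have h2 : star c * P.ip x x * c ≤ (N : ℂ) • (star c * c) := by
      refine (CStarAlgebra.star_left_conjugate_le_norm_smul (P.star_ip x x)).trans ?_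
      rw [Complex.coe_smul]
      exact smul_le_smul_of_nonneg_right hN.le (star_mul_self_nonneg _)
    have h3 : (N : ℂ) • (star c * c) ≤ (N : ℂ) • ((N : ℂ) • P.ip y y) := by
      rw [h1] at h0
      have := add_le_add h0 h2
      rw [← sub_nonneg] at this ⊢
      convert this using 1
      abel
    rw [Complex.coe_smul, Complex.coe_smul, Complex.coe_smul,
      smul_le_smul_iff_of_pos_left hN0] at h3
    have h4 := CStarAlgebra.norm_le_norm_of_nonneg_of_le (star_mul_self_nonneg c) h3
    rw [CStarRing.norm_star_mul_self, norm_smul, Real.norm_of_nonneg hN0.le] at h4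
    rwa [sq]
  have h5 : ‖P.ip x y‖ ^ 2 ≤ ‖P.ip x x‖ * ‖P.ip y y‖ := by
    refine le_of_forall_pos_le_add fun ε hε => ?_
    have hk := key (‖P.ip x x‖ + ε / (‖P.ip y y‖ + 1)) (by
      have : 0 < ε / (‖P.ip y y‖ + 1) := by positivity
      linarith)
    refine hk.trans ?_
    rw [add_mul]
    gcongr
    rw [div_mul_eq_mul_div, div_le_iff₀ (by positivity)]
    nlinarith [norm_nonneg (P.ip y y)]
  refine abs_le_of_sq_le_sq' ?_ (mul_nonneg (P.nrm_nonneg x) (P.nrm_nonneg y)) |>.2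
  rw [mul_pow, P.nrm_sq, P.nrm_sq]
  exact h5

lemma nrm_add_le (x y : E) : P.nrm (x + y) ≤ P.nrm x + P.nrm y := by
  refine abs_le_of_sq_le_sq' ?_ (add_nonneg (P.nrm_nonneg x) (P.nrm_nonneg y)) |>.2
  rw [P.nrm_sq, P.ip_add, P.ip_add_left, P.ip_add_left]
  have h1 := norm_add₃_le (a := P.ip x x + P.ip y x) (b := P.ip x y) (c := P.ip y y)
  have h2 := norm_add_le (P.ip x x) (P.ip y x)
  have h3 := P.norm_ip_le x y
  have h4 := P.norm_ip_le y x
  have h5 := P.nrm_sq x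
  have h6 := P.nrm_sq y
  rw [← add_assoc]
  nlinarith

lemma nrm_smul (c : ℂ) (x : E) : P.nrm (c • x) = ‖c‖ * P.nrm x := by
  rw [nrm, P.ip_smul, P.ip_smul_left, norm_smul, norm_smul, norm_star, ← mul_assoc,
    Real.sqrt_mul (by positivity), Real.sqrt_mul_self (norm_nonneg c), nrm]

lemma nrm_op (x : E) (a : A) : P.nrm (x <• a) ≤ ‖a‖ * P.nrm x := by
  refine abs_le_of_sq_le_sq' ?_ (mul_nonneg (norm_nonneg a) (P.nrm_nonneg x)) |>.2
  rw [P.nrm_sq, P.ip_op, P.ip_op_left, mul_pow, P.nrm_sq]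
  calc _ ≤ ‖star a‖ * ‖P.ip x x‖ * ‖a‖ := (norm_mul_le _ _).trans (by gcongr; exact norm_mul_le _ _)
    _ = _ := by rw [norm_star]; ring

lemma nrm_v (g : G) (x : E) : P.nrm (P.v g x) = P.nrm x := by
  rw [nrm, P.ip_v, nrm, NonUnitalStarAlgHom.norm_map (S.α g) (S.α g).injective]

lemma nrm_ρ (a : A) (x : E) : P.nrm (P.ρ a x) ≤ ‖a‖ * P.nrm x := by
  let _ := CStarAlgebra.spectralOrder A
  have := CStarAlgebra.spectralOrderedRing A
  refine abs_le_of_sq_le_sq' ?_ (mul_nonneg (norm_nonneg a) (P.nrm_nonneg x)) |>.2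
  have h1 : 0 ≤ algebraMap ℝ A (‖a‖ ^ 2) - star a * a := by
    rw [sub_nonneg]; exact CStarAlgebra.star_mul_le_algebraMap_norm_sq
  obtain ⟨c, hc⟩ := CStarAlgebra.nonneg_iff_eq_star_mul_self.mp h1
  have h2 : P.ip (P.ρ c x) (P.ρ c x) = (‖a‖ ^ 2 : ℝ) • P.ip x x - P.ip (P.ρ a x) (P.ρ a x) := by
    rw [P.ρ_adj, P.ρ_adj, ← Module.End.mul_apply, ← Module.End.mul_apply, ← map_mul, ← map_mul,
      ← hc, map_sub, LinearMap.sub_apply, P.ip_sub]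
    congr 1
    have : algebraMap ℝ A (‖a‖ ^ 2) = algebraMap ℂ A ((‖a‖ ^ 2 : ℝ) : ℂ) := by
      rw [Algebra.algebraMap_eq_smul_one, Algebra.algebraMap_eq_smul_one, Complex.coe_smul]
    rw [this, AlgHom.commutes, Module.algebraMap_end_apply, P.ip_smul, Complex.coe_smul]
  have h3 : P.ip (P.ρ a x) (P.ρ a x) ≤ (‖a‖ ^ 2 : ℝ) • P.ip x x := by
    rw [← sub_nonneg, ← h2]
    exact CStarAlgebra.nonneg_iff_eq_star_mul_self.mpr (P.ip_nonneg _)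
  have h4 := CStarAlgebra.norm_le_norm_of_nonneg_of_le
    (CStarAlgebra.nonneg_iff_eq_star_mul_self.mpr (P.ip_nonneg _)) h3
  rw [norm_smul, Real.norm_of_nonneg (by positivity)] at h4
  rwa [mul_pow, P.nrm_sq, P.nrm_sq]

end PreRep
end TwistedSystem

namespace TwistedSystem.PreRep

open UniformSpace

variable {G : Type*} [Group G] {A : Type*} [CStarAlgebra A] {S : TwistedSystem G A}
  {E : Type*} [AddCommGroup E] [Module ℂ E] [Module Aᵐᵒᵖ E] (P : PreRep S E)

/-- A copy of `E` with the seminorm given by the inner product. -/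
def Space (_P : PreRep S E) : Type _ := E

instance : AddCommGroup P.Space := inferInstanceAs (AddCommGroup E)
instance : Module ℂ P.Space := inferInstanceAs (Module ℂ E)
instance : Module Aᵐᵒᵖ P.Space := inferInstanceAs (Module Aᵐᵒᵖ E)
noncomputable instance : Norm P.Space := ⟨P.nrm⟩
instance : Inner A P.Space := ⟨P.ip⟩

lemma core : SeminormedSpace.Core ℂ P.Space where
  norm_nonneg := P.nrm_nonneg
  norm_smul := P.nrm_smul
  norm_triangle := P.nrm_add_le

noncomputable instance : SeminormedAddCommGroup P.Space := SeminormedAddCommGroup.ofCore P.core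
noncomputable instance : NormedSpace ℂ P.Space where
  norm_smul_le c x := (P.nrm_smul c x).le

lemma norm_op_le (b : Aᵐᵒᵖ) (x : P.Space) : ‖b • x‖ ≤ ‖b.unop‖ * ‖x‖ := P.nrm_op x b.unop

instance : UniformContinuousConstSMul Aᵐᵒᵖ P.Space where
  uniformContinuous_const_smul b :=
    (AddMonoidHomClass.lipschitz_of_bound (DistribSMul.toAddMonoidHom P.Space b) ‖b.unop‖
      (P.norm_op_le b)).uniformContinuous

lemma continuous_ip : Continuous fun p : P.Space × P.Space => ⟪p.1, p.2⟫_A := by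
  let f : P.Space →ₗ⋆[ℂ] P.Space →ₗ[ℂ] A := LinearMap.mk₂'ₛₗ _ _ (fun x y => P.ip x y)
    P.ip_add_left (fun c x y => P.ip_smul_left x y c) P.ip_add (fun c x y => P.ip_smul x y c)
  let F := f.mkContinuous₂ 1 fun x y => by rw [one_mul]; exact P.norm_ip_le x y
  exact (F.continuous.comp continuous_fst).clm_apply continuous_snd

/-- The canonical map from `E` to the completion. -/
noncomputable def j (x : E) : Completion P.Space := Completion.coe' (α := P.Space) x

lemma j_add (x y : E) : P.j (x + y) = P.j x + P.j y := Completion.coe_add (α := P.Space) x y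

lemma j_sub (x y : E) : P.j (x - y) = P.j x - P.j y := Completion.coe_sub (α := P.Space) x y

lemma j_zero : P.j 0 = 0 := Completion.coe_zero (α := P.Space)

lemma j_smul (c : ℂ) (x : E) : P.j (c • x) = c • P.j x :=
  Completion.coe_smul (X := P.Space) c x

lemma j_op (b : Aᵐᵒᵖ) (x : E) : P.j (b • x) = b • P.j x :=
  Completion.coe_smul (X := P.Space) b x

lemma norm_j (x : E) : ‖P.j x‖ = P.nrm x := Completion.norm_coe (E := P.Space) x

lemma inner_j (x y : E) : ⟪P.j x, P.j y⟫_A = P.ip x y :=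
  (Completion.isDenseInducing_coe.prodMap Completion.isDenseInducing_coe).extend_eq
    P.continuous_ip ((x : P.Space), (y : P.Space))

@[elab_as_elim]
lemma ind₁ {p : Completion P.Space → Prop} (x : Completion P.Space) (hp : IsClosed {x | p x})
    (h : ∀ x, p (P.j x)) : p x := Completion.induction_on x hp h

@[elab_as_elim]
lemma ind₂ {p : Completion P.Space → Completion P.Space → Prop} (x y : Completion P.Space)
    (hp : IsClosed {x : Completion P.Space × Completion P.Space | p x.1 x.2})
    (h : ∀ x y, p (P.j x) (P.j y)) : p x y := Completion.induction_on₂ x y hp h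

@[elab_as_elim]
lemma ind₃ {p : Completion P.Space → Completion P.Space → Completion P.Space → Prop}
    (x y z : Completion P.Space)
    (hp : IsClosed {x : Completion P.Space × Completion P.Space × Completion P.Space |
      p x.1 x.2.1 x.2.2})
    (h : ∀ x y z, p (P.j x) (P.j y) (P.j z)) : p x y z := Completion.induction_on₃ x y z hp h

lemma continuous_inner :
    Continuous fun p : Completion P.Space × Completion P.Space => ⟪p.1, p.2⟫_A := by
  let f : P.Space →+ P.Space →+ A := AddMonoidHom.mk' (fun x => AddMonoidHom.mk' (P.ip x) (P.ip_add x))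
    fun x y => by ext z; exact P.ip_add_left x y z
  have : Continuous fun p : P.Space × P.Space => f p.1 p.2 := P.continuous_ip
  exact (Completion.isDenseInducing_toCompl P.Space).extend_Z_bilin
    (Completion.isDenseInducing_toCompl P.Space) this

lemma continuous_inner' {X : Type*} [TopologicalSpace X] {f g : X → Completion P.Space}
    (hf : Continuous f) (hg : Continuous g) : Continuous fun x => ⟪f x, g x⟫_A :=
  P.continuous_inner.comp (hf.prodMk hg)

noncomputable instance : Module Aᵐᵒᵖ (Completion P.Space) where
  smul_zero b := by rw [← P.j_zero, ← j_op, smul_zero]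
  zero_smul x := by
    refine P.ind₁ x (isClosed_eq (continuous_const_smul _) continuous_const) fun x => ?_
    rw [← j_op, zero_smul, j_zero]
  smul_add b x y := by
    refine P.ind₂ x y (isClosed_eq ?_ ?_) fun x y => ?_
    · exact (continuous_const_smul b).comp (continuous_fst.add continuous_snd)
    · exact ((continuous_const_smul b).comp continuous_fst).add
        ((continuous_const_smul b).comp continuous_snd)
    · rw [← j_add, ← j_op, ← j_op, ← j_op, ← j_add, smul_add]
  add_smul b c x := by
    refine P.ind₁ x (isClosed_eq ?_ ?_) fun x => ?_
    · exact continuous_const_smul _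
    · exact (continuous_const_smul b).add (continuous_const_smul c)
    · rw [← j_op, ← j_op, ← j_op, ← j_add, add_smul]

noncomputable instance : RightHilbertModule A (Completion P.Space) where
  inner_add_right x y z := by
    refine P.ind₃ x y z (isClosed_eq ?_ ?_) fun x y z => ?_
    · exact P.continuous_inner' (by fun_prop) (by fun_prop)
    · exact (P.continuous_inner' (by fun_prop) (by fun_prop)).add
        (P.continuous_inner' (by fun_prop) (by fun_prop))
    · rw [← j_add, inner_j, inner_j, inner_j, P.ip_add]
  inner_smul_right x y c := by
    have h : Continuous fun y : Completion P.Space => c • y := continuous_const_smul c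
    refine P.ind₂ x y (isClosed_eq ?_ ?_) fun x y => ?_
    · exact P.continuous_inner' continuous_fst (h.comp continuous_snd)
    · exact Continuous.const_smul P.continuous_inner c
    · rw [← j_smul, inner_j, inner_j, P.ip_smul]
  inner_op_smul_right x y b := by
    refine P.ind₂ x y (isClosed_eq ?_ ?_) fun x y => ?_
    · exact P.continuous_inner' continuous_fst ((continuous_const_smul _).comp continuous_snd)
    · exact P.continuous_inner.mul continuous_const
    · rw [← j_op, inner_j, inner_j, P.ip_op]
  star_inner x y := by
    refine P.ind₂ x y (isClosed_eq ?_ ?_) fun x y => ?_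
    · exact P.continuous_inner.star
    · exact P.continuous_inner' continuous_snd continuous_fst
    · rw [inner_j, inner_j, P.star_ip]
  inner_self_nonneg x := by
    let _ := CStarAlgebra.spectralOrder A
    have := CStarAlgebra.spectralOrderedRing A
    simp only [← CStarAlgebra.nonneg_iff_eq_star_mul_self]
    refine P.ind₁ x ?_ fun x => ?_
    · exact CStarAlgebra.isClosed_nonneg.preimage (P.continuous_inner' continuous_id continuous_id)
    · rw [inner_j]
      exact CStarAlgebra.nonneg_iff_eq_star_mul_self.mpr (P.ip_nonneg x)
  norm_sq_eq x := by
    refine P.ind₁ x (isClosed_eq ?_ ?_) fun x => ?_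
    · fun_prop
    · exact (P.continuous_inner' continuous_id continuous_id).norm
    · rw [inner_j, norm_j, P.nrm_sq]
  complete := inferInstance

/-- The extension of a bounded linear map to the completion. -/
noncomputable def cmap (f : E →ₗ[ℂ] E) (C : ℝ) (hf : ∀ x, P.nrm (f x) ≤ C * P.nrm x) :
    Completion P.Space →L[ℂ] Completion P.Space :=
  let F : P.Space →L[ℂ] P.Space := LinearMap.mkContinuous (E := P.Space) (F := P.Space) f C hf
  have hF : ∀ x, Completion.map F (P.j x) = P.j (f x) :=
    Completion.map_coe (α := P.Space) F.uniformContinuous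
  have hc : Continuous (Completion.map F) := Completion.continuous_map
  { toFun := Completion.map F
    map_add' := fun x y => by
      refine P.ind₂ x y (isClosed_eq ?_ ?_) fun x y => ?_
      · exact hc.comp (continuous_fst.add continuous_snd)
      · exact (hc.comp continuous_fst).add (hc.comp continuous_snd)
      · rw [← j_add, hF, hF, hF, map_add, j_add]
    map_smul' := fun c x => by
      refine P.ind₁ x (isClosed_eq ?_ ?_) fun x => ?_
      · exact hc.comp (continuous_const_smul c)
      · exact Continuous.const_smul hc c
      · rw [← j_smul, hF, hF, map_smul, j_smul, RingHom.id_apply]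
    cont := hc }

lemma cmap_j (f : E →ₗ[ℂ] E) (C : ℝ) (hf : ∀ x, P.nrm (f x) ≤ C * P.nrm x) (x : E) :
    P.cmap f C hf (P.j x) = P.j (f x) :=
  Completion.map_coe (LinearMap.mkContinuous (E := P.Space) (F := P.Space) f C hf).uniformContinuous
    x

lemma j_eq_of_ip_eq (x y : E) (h : ∀ z, P.ip z x = P.ip z y) : P.j x = P.j y := by
  rw [← sub_eq_zero, ← j_sub, ← norm_eq_zero, norm_j, nrm, P.ip_sub, h, sub_self, norm_zero,
    Real.sqrt_zero]

/-- The representation of `A` on the completion. -/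
noncomputable def hilbertRep : HilbertRep A A (Completion P.Space) where
  act := AlgHom.ofLinearMap
    { toFun := fun a => P.cmap (P.ρ a) ‖a‖ (P.nrm_ρ a)
      map_add' := fun a b => by
        ext x
        refine P.ind₁ x (isClosed_eq (by fun_prop) (by fun_prop)) fun x => ?_
        rw [cmap_j, add_apply, cmap_j, cmap_j, map_add, LinearMap.add_apply, j_add]
      map_smul' := fun c a => by
        ext x
        refine P.ind₁ x (isClosed_eq (by fun_prop) ?_) fun x => ?_
        · exact ContinuousLinearMap.continuous _
        · rw [cmap_j, RingHom.id_apply, smul_apply, cmap_j, map_smul, LinearMap.smul_apply, j_smul] }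
    (by
      ext x
      refine P.ind₁ x (isClosed_eq (ContinuousLinearMap.continuous _)
        (ContinuousLinearMap.continuous _)) fun x => ?_
      rw [LinearMap.coe_mk, AddHom.coe_mk, cmap_j, map_one, Module.End.one_apply]; rfl)
    (fun a b => by
      ext x
      refine P.ind₁ x (isClosed_eq (ContinuousLinearMap.continuous _)
        (ContinuousLinearMap.continuous _)) fun x => ?_
      rw [LinearMap.coe_mk, AddHom.coe_mk, mul_apply_eq_comp, cmap_j, cmap_j, cmap_j,
        map_mul, Module.End.mul_apply])
  adjoint a x y := by
    refine P.ind₂ x y (isClosed_eq ?_ ?_) fun x y => ?_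
    · exact P.continuous_inner' (by fun_prop) (by fun_prop)
    · exact P.continuous_inner' (by fun_prop) (by fun_prop)
    · simp only [AlgHom.ofLinearMap_apply, LinearMap.coe_mk, AddHom.coe_mk]
      rw [cmap_j, cmap_j, inner_j, inner_j, P.ρ_adj]

lemma hilbertRep_j (a : A) (x : E) : P.hilbertRep.act a (P.j x) = P.j (P.ρ a x) :=
  P.cmap_j _ _ _ x

lemma nrm_v_symm (g : G) (x : E) : P.nrm ((P.v g).symm x) = P.nrm x := by
  rw [← P.nrm_v g, LinearEquiv.apply_symm_apply]

/-- The extension of `v g` to the completion. -/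
noncomputable def cv (g : G) : Completion P.Space ≃L[ℂ] Completion P.Space :=
  ContinuousLinearEquiv.equivOfInverse
    (P.cmap (P.v g) 1 fun x => by rw [one_mul]; exact (P.nrm_v g x).le)
    (P.cmap (P.v g).symm 1 fun x => by rw [one_mul]; exact (P.nrm_v_symm g x).le)
    (fun x => by
      refine P.ind₁ x (isClosed_eq (by fun_prop) (by fun_prop)) fun x => ?_
      rw [cmap_j, cmap_j]; simp)
    (fun x => by
      refine P.ind₁ x (isClosed_eq (by fun_prop) (by fun_prop)) fun x => ?_
      rw [cmap_j, cmap_j]; simp)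

lemma cv_j (g : G) (x : E) : P.cv g (P.j x) = P.j (P.v g x) := P.cmap_j _ _ _ x

/-- The equivariant representation on the completion. -/
noncomputable def equivariantRep : EquivariantRep S (Completion P.Space) where
  ρ := P.hilbertRep
  v := P.cv
  ρ_α g a x := by
    have key : ∀ y, P.hilbertRep.act (S.α g a) (P.cv g y) = P.cv g (P.hilbertRep.act a y) := by
      intro y
      refine P.ind₁ y (isClosed_eq (by fun_prop) (by fun_prop)) fun y => ?_
      rw [cv_j, hilbertRep_j, hilbertRep_j, cv_j, P.v_ρ]
    rw [← key, ContinuousLinearEquiv.apply_symm_apply]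
  v_v g h x := by
    refine P.ind₁ x (isClosed_eq (by fun_prop) ?_) fun x => ?_
    · exact (continuous_const_smul _).comp (by fun_prop)
    · rw [cv_j, cv_j, cv_j, hilbertRep_j, ← j_op]
      exact P.j_eq_of_ip_eq _ _ fun z => P.v_v g h x z
  inner_v g x y := by
    have : Continuous (S.α g) := (NonUnitalStarAlgHom.isometry (S.α g) (S.α g).injective).continuous
    refine P.ind₂ x y (isClosed_eq ?_ ?_) fun x y => ?_
    · exact this.comp P.continuous_inner
    · exact P.continuous_inner' (by fun_prop) (by fun_prop)
    · rw [cv_j, cv_j, inner_j, inner_j, P.ip_v]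
  v_op_smul g x a := by
    refine P.ind₁ x (isClosed_eq ?_ ?_) fun x => ?_
    · exact (P.cv g).continuous.comp (continuous_const_smul _)
    · exact (continuous_const_smul _).comp (P.cv g).continuous
    · rw [cv_j, ← j_op, ← j_op, cv_j, P.v_op]

end TwistedSystem.PreRep

/-- The maps `(g, a) ↦ ⟨x, ρ(a) v(g) y⟩` of a `PreRep` are coefficient functions. -/
lemma TwistedSystem.PreRep.hasDecomposition {G : Type v} [Group G] {A : Type u} [CStarAlgebra A]
    {S : TwistedSystem G A} {E : Type (max u v)} [AddCommGroup E] [Module ℂ E] [Module Aᵐᵒᵖ E]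
    (P : PreRep S E) (x y : E) (T : LAlg G A) (hT : ∀ g a, T g a = P.ip x (P.ρ a (P.v g y))) :
    ∃ r, S.HasDecomposition T r := by
  refine ⟨_, UniformSpace.Completion P.Space, inferInstance, inferInstance, inferInstance,
    inferInstance, P.equivariantRep, P.j x, P.j y, ?_, rfl⟩
  ext g a
  rw [hT]
  change _ = ⟪_, P.hilbertRep.act a (P.cv g _)⟫_A
  rw [PreRep.cv_j, PreRep.hilbertRep_j, PreRep.inner_j]

namespace RightHilbertModule

variable {B : Type*} [CStarAlgebra B] {X : Type*} [NormedAddCommGroup X] [NormedSpace ℂ X]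
  [Module Bᵐᵒᵖ X] [RightHilbertModule B X]

lemma inner_add_left (x y z : X) : ⟪x + y, z⟫_B = ⟪x, z⟫_B + ⟪y, z⟫_B := by
  rw [← star_inner, inner_add_right, star_add, star_inner, star_inner]

lemma inner_smul_left (x y : X) (c : ℂ) : ⟪c • x, y⟫_B = star c • ⟪x, y⟫_B := by
  rw [← star_inner, inner_smul_right, star_smul, star_inner]

lemma inner_op_smul_left (x y : X) (b : B) : ⟪x <• b, y⟫_B = star b * ⟪x, y⟫_B := by
  rw [← star_inner, inner_op_smul_right, star_mul, star_inner]

lemma inner_sum_right {ι : Type*} (s : Finset ι) (x : X) (f : ι → X) :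
    ⟪x, ∑ i ∈ s, f i⟫_B = ∑ i ∈ s, ⟪x, f i⟫_B :=
  map_sum (AddMonoidHom.mk' (fun y : X => ⟪x, y⟫_B) (inner_add_right x)) f s

lemma inner_sum_left {ι : Type*} (s : Finset ι) (x : X) (f : ι → X) :
    ⟪∑ i ∈ s, f i, x⟫_B = ∑ i ∈ s, ⟪f i, x⟫_B :=
  map_sum (AddMonoidHom.mk' (fun y : X => ⟪y, x⟫_B) fun y z => inner_add_left y z x) f s

lemma ext_inner {x y : X} (h : ∀ z : X, ⟪z, x⟫_B = ⟪z, y⟫_B) : x = y := by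
  have h0 : ⟪x - y, x - y⟫_B = 0 := by
    have : ⟪x - y, (x - y) + y⟫_B = ⟪x - y, y⟫_B := by rw [sub_add_cancel, h]
    rw [inner_add_right] at this
    simpa using this
  have h1 := norm_sq_eq (B := B) (x - y)
  rw [h0, norm_zero] at h1
  exact sub_eq_zero.mp (norm_eq_zero.mp (pow_eq_zero_iff two_ne_zero |>.mp h1))

variable (B X) in
lemma smulCommClass : SMulCommClass ℂ Bᵐᵒᵖ X where
  smul_comm c b x := ext_inner (B := B) fun z => by
    induction b with | _ b =>
    rw [inner_smul_right, inner_op_smul_right, inner_op_smul_right, inner_smul_right,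
      smul_mul_assoc]

end RightHilbertModule

namespace HilbertRep

variable {A B X : Type*} [CStarAlgebra A] [CStarAlgebra B] [NormedAddCommGroup X]
  [NormedSpace ℂ X] [Module Bᵐᵒᵖ X] [RightHilbertModule B X] (κ : HilbertRep A B X)

lemma act_op (a : A) (x : X) (b : B) : κ.act a (x <• b) = κ.act a x <• b :=
  RightHilbertModule.ext_inner (B := B) fun z => by
    rw [← star_star a, ← κ.adjoint, RightHilbertModule.inner_op_smul_right, κ.adjoint,
      RightHilbertModule.inner_op_smul_right]

/-- The representation as a homomorphism to linear maps. -/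
def lin : A →ₐ[ℂ] Module.End ℂ X :=
  AlgHom.ofLinearMap
    { toFun := fun a => (κ.act a : X →ₗ[ℂ] X)
      map_add' := fun a b => by ext; simp
      map_smul' := fun c a => by ext; simp }
    (by ext; simp) (fun a b => by ext; simp)

@[simp] lemma lin_apply (a : A) (x : X) : κ.lin a x = κ.act a x := rfl

end HilbertRep

lemma exists_star_mul_self_add {A : Type*} [CStarAlgebra A] {x y : A}
    (hx : ∃ a, x = star a * a) (hy : ∃ a, y = star a * a) : ∃ a, x + y = star a * a := by
  let _ := CStarAlgebra.spectralOrder A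
  have := CStarAlgebra.spectralOrderedRing A
  rw [← CStarAlgebra.nonneg_iff_eq_star_mul_self] at *
  exact add_nonneg hx hy

namespace EquivariantRep

open TwistedSystem TensorProduct
open RightHilbertModule renaming inner_add_right → hadd_right, inner_smul_right → hsmul_right, inner_op_smul_right → hop_right, inner_add_left → hadd_left, inner_smul_left → hsmul_left, inner_op_smul_left → hop_left, inner_sum_right → hsum_right, inner_sum_left → hsum_left, star_inner → hstar, inner_self_nonneg → hnonneg, ext_inner → hext, smulCommClass → hcomm

variable {G : Type*} [Group G] {A : Type*} [CStarAlgebra A] {S : TwistedSystem G A}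
  {X : Type*} [NormedAddCommGroup X] [NormedSpace ℂ X] [Module Aᵐᵒᵖ X] [RightHilbertModule A X]
  {Y : Type*} [NormedAddCommGroup Y] [NormedSpace ℂ Y] [Module Aᵐᵒᵖ Y] [RightHilbertModule A Y]
  (π : EquivariantRep S X) (τ : EquivariantRep S Y)

lemma v_act (g : G) (a : A) (x : X) : π.v g (π.ρ.act a x) = π.ρ.act (S.α g a) (π.v g x) := by
  rw [π.ρ_α, ContinuousLinearEquiv.symm_apply_apply]

/-- The direct sum of two equivariant representations. -/
noncomputable def sum : PreRep S (X × Y) where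
  ip p q := ⟪p.1, q.1⟫_A + ⟪p.2, q.2⟫_A
  ip_add p q r := by simp only [Prod.fst_add, Prod.snd_add, hadd_right]; abel
  ip_smul p q c := by simp only [Prod.smul_fst, Prod.smul_snd, hsmul_right, smul_add]
  ip_op p q a := by simp only [Prod.smul_fst, Prod.smul_snd, hop_right, add_mul]
  star_ip p q := by simp only [star_add, hstar]
  ip_nonneg p := exists_star_mul_self_add (hnonneg _) (hnonneg _)
  ρ := (LinearMap.prodMapAlgHom ℂ X Y).comp (π.ρ.lin.prod τ.ρ.lin)
  ρ_adj a p q := by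
    simp [π.ρ.adjoint, τ.ρ.adjoint]
  v g := (π.v g).toLinearEquiv.prodCongr (τ.v g).toLinearEquiv
  v_ρ g a p := by simp [v_act]
  v_op g p a := by ext <;> simp [v_op_smul]
  ip_v g p q := by rw [map_add, π.inner_v, τ.inner_v]; rfl
  v_v g h p r := by simp [v_v]

/-- The pairing of `x ⊗ y` with an element of `X ⊗ Y` in the internal tensor product. -/
noncomputable def tensorIp₁ (x : X) (y : Y) : X ⊗[ℂ] Y →ₗ[ℂ] A :=
  TensorProduct.lift (LinearMap.mk₂ ℂ (fun x' y' => ⟪x, π.ρ.act ⟪y, y'⟫_A x'⟫_A)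
    (fun x₁ x₂ y' => by rw [map_add, hadd_right])
    (fun c x' y' => by rw [map_smul, hsmul_right])
    (fun x' y₁ y₂ => by rw [hadd_right, map_add, add_apply, hadd_right])
    (fun c x' y' => by rw [hsmul_right, map_smul, smul_apply, hsmul_right]))

lemma tensorIp₁_tmul (x x' : X) (y y' : Y) :
    π.tensorIp₁ x y (x' ⊗ₜ y') = ⟪x, π.ρ.act ⟪y, y'⟫_A x'⟫_A := rfl

/-- The conjugate pairing with a fixed element of `X ⊗ Y`. -/
noncomputable def tensorIp₂ (w : X ⊗[ℂ] Y) : X ⊗[ℂ] Y →ₗ[ℂ] A :=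
  TensorProduct.lift (LinearMap.mk₂ ℂ (fun x y => star (π.tensorIp₁ x y w))
    (fun x₁ x₂ y => by
      rw [← star_add]; congr 1
      induction w with
      | zero => simp
      | tmul x' y' => simp only [tensorIp₁_tmul, hadd_left]
      | add a b ha hb => simp only [map_add, ha, hb]; abel)
    (fun c x y => by
      rw [← star_star c, ← star_smul]; congr 1
      induction w with
      | zero => simp
      | tmul x' y' => simp only [tensorIp₁_tmul, hsmul_left, star_star]
      | add a b ha hb => simp only [map_add, ha, hb, smul_add])
    (fun x y₁ y₂ => by
      rw [← star_add]; congr 1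
      induction w with
      | zero => simp
      | tmul x' y' =>
        simp only [tensorIp₁_tmul, hadd_left, map_add, add_apply, hadd_right]
      | add a b ha hb => simp only [map_add, ha, hb]; abel)
    (fun c x y => by
      rw [← star_star c, ← star_smul]; congr 1
      induction w with
      | zero => simp
      | tmul x' y' =>
        simp only [tensorIp₁_tmul, hsmul_left, star_star, map_smul, smul_apply,
          hsmul_right]
      | add a b ha hb => simp only [map_add, ha, hb, smul_add]))

/-- The inner product of the internal tensor product, on the algebraic tensor product. -/
noncomputable def tensorIp (z w : X ⊗[ℂ] Y) : A := star (π.tensorIp₂ w z)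

lemma tensorIp_tmul_left (x : X) (y : Y) (w : X ⊗[ℂ] Y) :
    π.tensorIp (x ⊗ₜ y) w = π.tensorIp₁ x y w := star_star _

lemma tensorIp_add_left (z z' w : X ⊗[ℂ] Y) :
    π.tensorIp (z + z') w = π.tensorIp z w + π.tensorIp z' w := by
  simp [tensorIp]

lemma tensorIp_zero_left (w : X ⊗[ℂ] Y) : π.tensorIp 0 w = 0 := by simp [tensorIp]

lemma tensorIp_add (z w w' : X ⊗[ℂ] Y) :
    π.tensorIp z (w + w') = π.tensorIp z w + π.tensorIp z w' := by
  induction z with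
  | zero => simp [tensorIp_zero_left]
  | tmul x y => simp [tensorIp_tmul_left]
  | add a b ha hb => simp only [tensorIp_add_left, ha, hb]; abel

lemma tensorIp_zero (z : X ⊗[ℂ] Y) : π.tensorIp z 0 = 0 := by
  simpa using π.tensorIp_add z 0 0

lemma tensorIp_smul (z w : X ⊗[ℂ] Y) (c : ℂ) :
    π.tensorIp z (c • w) = c • π.tensorIp z w := by
  induction z with
  | zero => simp [tensorIp_zero_left]
  | tmul x y => simp [tensorIp_tmul_left]
  | add a b ha hb => simp only [tensorIp_add_left, ha, hb, smul_add]

lemma tensorIp_tmul (x x' : X) (y y' : Y) :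
    π.tensorIp (x ⊗ₜ y) (x' ⊗ₜ y') = ⟪x, π.ρ.act ⟪y, y'⟫_A x'⟫_A := by
  rw [tensorIp_tmul_left, tensorIp₁_tmul]

lemma tensorIp_sum {ι : Type*} (s : Finset ι) (f g : ι → X ⊗[ℂ] Y) :
    π.tensorIp (∑ i ∈ s, f i) (∑ j ∈ s, g j) = ∑ i ∈ s, ∑ j ∈ s, π.tensorIp (f i) (g j) := by
  have h1 : ∀ w, π.tensorIp (∑ i ∈ s, f i) w = ∑ i ∈ s, π.tensorIp (f i) w := fun w =>
    map_sum (AddMonoidHom.mk' (fun z => π.tensorIp z w) fun y z => π.tensorIp_add_left y z w) f s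
  have h2 : ∀ z, π.tensorIp z (∑ i ∈ s, g i) = ∑ i ∈ s, π.tensorIp z (g i) := fun z =>
    map_sum (AddMonoidHom.mk' (π.tensorIp z) (π.tensorIp_add z)) g s
  simp only [h1, h2]

lemma tensorIp_nonneg (z : X ⊗[ℂ] Y) : ∃ b, π.tensorIp z z = star b * b := by
  classical
  let _ := CStarAlgebra.spectralOrder A
  have := CStarAlgebra.spectralOrderedRing A
  obtain ⟨s, hs⟩ := TensorProduct.exists_finset z
  obtain ⟨C, hC⟩ := exists_matrix_factorization (n := s) (fun i j => ⟪i.1.2, j.1.2⟫_A)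
    (fun i j => hstar _ _) (fun c => by
      have h := CStarAlgebra.nonneg_iff_eq_star_mul_self.mpr
        (hnonneg (B := A) (∑ i : s, i.1.2 <• c i))
      simp only [hsum_left, hsum_right, hop_left, hop_right, Finset.sum_mul] at h
      rw [Finset.sum_comm]
      exact h)
  have h1 : π.tensorIp z z = ∑ k : s, ⟪∑ i : s, π.ρ.act (C k i) i.1.1,
      ∑ i : s, π.ρ.act (C k i) i.1.1⟫_A := by
    rw [hs, ← Finset.sum_coe_sort, tensorIp_sum]
    simp only [tensorIp_tmul, hC, map_sum, sum_apply, hsum_left,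
      hsum_right, map_mul, mul_apply_eq_comp]
    simp only [π.ρ.adjoint]
    rw [Finset.sum_comm_cycle]
    exact Finset.sum_congr rfl fun k _ => Finset.sum_comm
  rw [h1, ← CStarAlgebra.nonneg_iff_eq_star_mul_self]
  exact Finset.sum_nonneg fun k _ =>
    CStarAlgebra.nonneg_iff_eq_star_mul_self.mpr (hnonneg _)

/-- The tensor product of two equivariant representations: `x ⊗ y` with `x ∈ X`, `y ∈ Y` stands for
`y ⊗ x` in the internal tensor product of `Y` and `X` over `A`. -/
noncomputable def tensor [SMulCommClass ℂ Aᵐᵒᵖ X] : PreRep S (X ⊗[ℂ] Y) where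
  ip := π.tensorIp
  ip_add := π.tensorIp_add
  ip_smul := π.tensorIp_smul
  ip_op z w a := by
    induction z with
    | zero => simp [tensorIp_zero_left]
    | add z z' h h' => simp only [tensorIp_add_left, h, h', add_mul]
    | tmul x y =>
      induction w with
      | zero => simp [tensorIp_zero]
      | add w w' h h' => simp only [smul_add, tensorIp_add, h, h', add_mul]
      | tmul x' y' =>
        rw [TensorProduct.smul_tmul', tensorIp_tmul, tensorIp_tmul, HilbertRep.act_op, hop_right]
  star_ip z w := by
    induction z with
    | zero => simp [tensorIp_zero_left, tensorIp_zero]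
    | add z z' h h' => simp only [tensorIp_add_left, tensorIp_add, star_add, h, h']
    | tmul x y =>
      induction w with
      | zero => simp [tensorIp_zero_left, tensorIp_zero]
      | add w w' h h' => simp only [tensorIp_add_left, tensorIp_add, star_add, h, h']
      | tmul x' y' =>
        rw [tensorIp_tmul, tensorIp_tmul, hstar, π.ρ.adjoint, hstar]
  ip_nonneg := π.tensorIp_nonneg
  ρ := (Module.End.lTensorAlgHom ℂ Y X).comp τ.ρ.lin
  ρ_adj a z w := by
    induction z with
    | zero => simp [tensorIp_zero_left]
    | add z z' h h' => simp only [map_add, tensorIp_add_left, h, h']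
    | tmul x y =>
      induction w with
      | zero => simp [tensorIp_zero]
      | add w w' h h' => simp only [map_add, tensorIp_add, h, h']
      | tmul x' y' =>
        change π.tensorIp (x ⊗ₜ τ.ρ.act a y) (x' ⊗ₜ y') =
          π.tensorIp (x ⊗ₜ y) (x' ⊗ₜ τ.ρ.act (star a) y')
        rw [tensorIp_tmul, tensorIp_tmul, τ.ρ.adjoint]
  v g := TensorProduct.congr (π.v g).toLinearEquiv (τ.v g).toLinearEquiv
  v_ρ g a z := by
    induction z with
    | zero => simp
    | add z z' h h' => simp only [map_add, h, h']
    | tmul x y =>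
      change (π.v g x ⊗ₜ τ.v g (τ.ρ.act a y) : X ⊗[ℂ] Y) =
        π.v g x ⊗ₜ τ.ρ.act (S.α g a) (τ.v g y)
      rw [τ.v_act]
  v_op g z a := by
    induction z with
    | zero => simp
    | add z z' h h' => simp only [smul_add, map_add, h, h']
    | tmul x y =>
      rw [TensorProduct.smul_tmul']
      change (π.v g (x <• a) ⊗ₜ τ.v g y : X ⊗[ℂ] Y) = (π.v g x ⊗ₜ τ.v g y) <• S.α g a
      rw [TensorProduct.smul_tmul', π.v_op_smul]
  ip_v g z w := by
    induction z with
    | zero => simp [tensorIp_zero_left]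
    | add z z' h h' => simp only [map_add, tensorIp_add_left, h, h']
    | tmul x y =>
      induction w with
      | zero => simp [tensorIp_zero]
      | add w w' h h' => simp only [map_add, tensorIp_add, h, h']
      | tmul x' y' =>
        change π.tensorIp (π.v g x ⊗ₜ τ.v g y) (π.v g x' ⊗ₜ τ.v g y') = _
        rw [tensorIp_tmul, tensorIp_tmul, ← τ.inner_v, ← π.v_act, ← π.inner_v]
  v_v g h w z := by
    induction z with
    | zero => simp [tensorIp_zero_left]
    | add z z' h h' => simp only [tensorIp_add_left, h, h']
    | tmul x y =>
      induction w with
      | zero => simp [tensorIp_zero]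
      | add w w' h h' => simp only [map_add, smul_add, tensorIp_add, h, h']
      | tmul x' y' =>
        change π.tensorIp (x ⊗ₜ y) (π.v g (π.v h x') ⊗ₜ τ.v g (τ.v h y')) =
          π.tensorIp (x ⊗ₜ y) ((π.v (g * h) x' ⊗ₜ τ.ρ.act (S.σ g h : A) (τ.v (g * h) y')) <•
            star (S.σ g h : A))
        rw [TensorProduct.smul_tmul', tensorIp_tmul, tensorIp_tmul, π.v_v, τ.v_v, hop_right,
          HilbertRep.act_op, hop_right, HilbertRep.act_op, hop_right, map_mul, mul_apply_eq_comp,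
          ← mul_apply_eq_comp (π.ρ.act (star (S.σ g h : A))), ← map_mul,
          Unitary.coe_star_mul_self, map_one]
        rfl

end EquivariantRep

/-- The trivial equivariant representation on `A`. -/
noncomputable def TwistedSystem.trivialRep {G : Type v} [Group G] {A : Type u} [CStarAlgebra A]
    (S : TwistedSystem G A) : PreRep S (ULift.{v} A) where
  ip x y := star x.down * y.down
  ip_add x y z := by simp [mul_add]
  ip_smul x y c := by simp
  ip_op x y a := by simp [mul_assoc]
  star_ip x y := by simp
  ip_nonneg x := ⟨x.down, rfl⟩
  ρ := Algebra.lsmul ℂ ℂ (ULift.{v} A)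
  ρ_adj a x y := by simp [mul_assoc]
  v g := ULift.moduleEquiv ≪≫ₗ (S.α g).toAlgEquiv.toLinearEquiv ≪≫ₗ ULift.moduleEquiv.symm
  v_ρ g a x := by ext; simp
  v_op g x a := by ext; simp
  ip_v g x y := by simp [map_star]
  v_v g h x z := by simp [S.α_α]

/-- The Fourier-Stieltjes algebra `B(Σ)`: all maps `G × A → A` of the form `T_{ρ,v,x,y}` for some
equivariant representation `(ρ, v)` of `Σ` on a Hilbert `A`-module `X` and `x, y ∈ X`. -/
def TwistedSystem.fourierStieltjes {G : Type v} [Group G] {A : Type u} [CStarAlgebra A]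
    (S : TwistedSystem G A) : Subalgebra ℂ (LAlg G A) where
  carrier := {T | ∃ r, S.HasDecomposition T r}
  mul_mem' := by
    rintro T T' ⟨_, X, _, _, _, _, π, x, y, rfl, -⟩ ⟨_, X', _, _, _, _, π', x', y', rfl, -⟩
    have := RightHilbertModule.smulCommClass A X
    refine (π.tensor π').hasDecomposition (x ⊗ₜ x') (y ⊗ₜ y') _ fun g a => ?_
    exact (π.tensorIp_tmul x (π.v g y) x' (π'.ρ.act a (π'.v g y'))).symm
  add_mem' := by
    rintro T T' ⟨_, X, _, _, _, _, π, x, y, rfl, -⟩ ⟨_, X', _, _, _, _, π', x', y', rfl, -⟩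
    exact (π.sum π').hasDecomposition (x, x') (y, y') _ fun g a => rfl
  algebraMap_mem' c := by
    refine S.trivialRep.hasDecomposition ⟨1⟩ ⟨c • 1⟩ _ fun g a => ?_
    simp [trivialRep]

/-- The norm of `B(Σ)`: the infimum of `‖x‖ ‖y‖` over all decompositions `T = T_{ρ,v,x,y}`. -/
noncomputable instance TwistedSystem.instNormFourierStieltjes {G : Type v} [Group G] {A : Type u}
    [CStarAlgebra A] (S : TwistedSystem G A) : Norm S.fourierStieltjes where
  norm T := sInf {r : ℝ | S.HasDecomposition (T : LAlg G A) r}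

/-! Over commutative algebras an imprimitivity bimodule carries the same endomorphisms from both
sides. For a in A the imprimitivity identity gives a·(z·⟨x, y⟩) = (a _A⟨z, x⟩)·y = (_A⟨z, x⟩ a)·y =
z·⟨x, a·y⟩, so on vectors z·⟨x, y⟩ the left action of a is a right action by an element of B.
Fullness together with a unit makes 1 a finite linear combination of inner products, hence a acts on
all of Z as some φ(a) in B (`exists_op_smul_eq_act`). The mirror computation
(`exists_act_eq_op_smul`) uses commutativity of B. Both actions are faithful, so φ is well defined,
and every algebraic property of φ can be checked on Z; it is a *-isomorphism
(`exists_starAlgEquiv`).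

A compatible action δ intertwines both module structures. Evaluating δ(g) on φ⁻¹(b)·z = z·b yields
φ(α_g(φ⁻¹(b))) = β_g(b), which is conjugacy. Conversely, an isomorphism φ makes B itself an A-B
imprimitivity bimodule, on which δ = β is compatible.

Fourier–Stieltjes algebras are compared through conjugacy. A Hilbert A-module becomes a Hilbert
B-module through φ without any change of the underlying space or its norm, and equivariant
representations remain equivariant. Thus T ↦ φ ∘ T ∘ φ⁻¹ matches decompositions of T and of its
image with the same values ‖x‖‖y‖; the infima agree (`hasDecomposition_lAlgConj_iff`). -/

/-! ### Full inner products over unital algebras and faithfulness of the actions -/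

/-- The span of a set that is closed under right multiplication contains `1` if it is dense. -/
lemma one_mem_span_of_topologicalClosure_eq_top {B : Type*} [CStarAlgebra B] (s : Set B)
    (hs : ∀ b ∈ s, ∀ c, b * c ∈ s) (h : (Submodule.span ℂ s).topologicalClosure = ⊤) :
    (1 : B) ∈ Submodule.span ℂ s := by
  rcases subsingleton_or_nontrivial B with hB | hB
  · rw [Subsingleton.elim (1 : B) 0]
    exact Submodule.zero_mem _
  have hmul : ∀ b ∈ Submodule.span ℂ s, ∀ c, b * c ∈ Submodule.span ℂ s := by
    intro b hb c
    induction hb using Submodule.span_induction with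
    | mem x hx => exact Submodule.subset_span (hs x hx c)
    | zero => simp
    | add x y _ _ hx hy => rw [add_mul]; exact Submodule.add_mem _ hx hy
    | smul k x _ hx => rw [smul_mul_assoc]; exact Submodule.smul_mem _ k hx
  have h1 : (1 : B) ∈ closure (Submodule.span ℂ s : Set B) := by
    rw [← Submodule.topologicalClosure_coe, h]
    trivial
  -- The units form an open set containing 1, so the dense right ideal contains a unit b, and
  -- therefore b b⁻¹ = 1.
  obtain ⟨_, ⟨b, rfl⟩, hb⟩ := mem_closure_iff.mp h1 _ (Units.isOpen (R := B)) isUnit_one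
  simpa using hmul _ hb (↑b⁻¹ : B)

namespace ImprimitivityBimodule

open RightHilbertModule

section Faithful

variable {A B Z : Type*} [CStarAlgebra A] [CStarAlgebra B] [NormedAddCommGroup Z]
  [NormedSpace ℂ Z] [Module Bᵐᵒᵖ Z] [RightHilbertModule B Z] (I : ImprimitivityBimodule A B Z)

-- Right multiples of inner products are again inner products, ⟨x, y⟩c = ⟨x, y·c⟩. With 1 in the
-- algebraic span, a claim linear in d needs checking only for d = ⟨x, y⟩ and is then used at d = 1,
-- with no limits involved.
include I in
lemma one_mem_span_inner : (1 : B) ∈ Submodule.span ℂ {b : B | ∃ x y : Z, ⟪x, y⟫_B = b} :=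
  one_mem_span_of_topologicalClosure_eq_top _
    (fun _ ⟨x, y, h⟩ c => ⟨x, y <• c, by rw [inner_op_smul_right, h]⟩) I.full_right

lemma leftInner_act_right (a : A) (x y : Z) :
    I.leftInner x (I.act a y) = I.leftInner x y * star a := by
  rw [← I.star_leftInner, I.leftInner_act_left, star_mul, I.star_leftInner]

lemma one_mem_span_leftInner :
    (1 : A) ∈ Submodule.span ℂ {a : A | ∃ x y : Z, I.leftInner x y = a} :=
  one_mem_span_of_topologicalClosure_eq_top _
    (fun _ ⟨x, y, h⟩ c => ⟨x, I.act (star c) y, by rw [leftInner_act_right, star_star, h]⟩)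
    I.full_left

include I in
/-- The right action on an imprimitivity bimodule is faithful. -/
lemma eq_of_op_smul_eq {b c : B} (h : ∀ z : Z, z <• b = z <• c) : b = c := by
  -- The condition d b = d c is linear in d, and ⟨x, y⟩b = ⟨x, y·b⟩ sees b only through its action.
  have key : ∀ d ∈ Submodule.span ℂ {b : B | ∃ x y : Z, ⟪x, y⟫_B = b}, d * b = d * c := by
    intro d hd
    induction hd using Submodule.span_induction with
    | mem d hd =>
      obtain ⟨x, y, rfl⟩ := hd
      rw [← inner_op_smul_right, h, inner_op_smul_right]
    | zero => simp
    | add x y _ _ hx hy => rw [add_mul, add_mul, hx, hy]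
    | smul k x _ hx => rw [smul_mul_assoc, smul_mul_assoc, hx]
  simpa using key 1 I.one_mem_span_inner

/-- The left action on an imprimitivity bimodule is faithful. -/
lemma eq_of_act_eq {a c : A} (h : ∀ z : Z, I.act a z = I.act c z) : a = c := by
  have key : ∀ d ∈ Submodule.span ℂ {a : A | ∃ x y : Z, I.leftInner x y = a},
      a * d = c * d := by
    intro d hd
    induction hd using Submodule.span_induction with
    | mem d hd =>
      obtain ⟨x, y, rfl⟩ := hd
      rw [← I.leftInner_act_left, h, I.leftInner_act_left]
    | zero => simp
    | add x y _ _ hx hy => rw [mul_add, mul_add, hx, hy]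
    | smul k x _ hx => rw [mul_smul_comm, mul_smul_comm, hx]
  simpa using key 1 I.one_mem_span_leftInner

end Faithful

/-! ### Commutative algebras: the isomorphism carried by a bimodule -/

variable {A B : Type*} {Z : Type*} [CommCStarAlgebra A] [CommCStarAlgebra B]
  [NormedAddCommGroup Z] [NormedSpace ℂ Z] [Module Bᵐᵒᵖ Z] [RightHilbertModule B Z]
  (I : ImprimitivityBimodule A B Z)

/-- The elements d for which z ↦ a·(z·d) is a right multiplication form a subspace. It contains
every inner product because a commutes with _A⟨z, x⟩, hence it contains 1. -/
lemma exists_op_smul_eq_act (a : A) : ∃ b : B, ∀ z : Z, I.act a z = z <• b := by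
  have := RightHilbertModule.smulCommClass B Z
  have key : ∀ d ∈ Submodule.span ℂ {b : B | ∃ x y : Z, ⟪x, y⟫_B = b},
      ∃ b : B, ∀ z : Z, I.act a (z <• d) = z <• b := by
    intro d hd
    induction hd using Submodule.span_induction with
    | mem d hd =>
      obtain ⟨x, y, rfl⟩ := hd
      -- Both sides become left actions on y, by a _A⟨z, x⟩ and by _A⟨z, x⟩ a; commutativity of A
      -- identifies them.
      refine ⟨⟪x, I.act a y⟫_B, fun z => ?_⟩
      rw [← I.leftInner_act, ← I.leftInner_act, ← mul_apply_eq_comp, ← mul_apply_eq_comp,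
        ← map_mul, ← map_mul, mul_comm]
    | zero => exact ⟨0, fun z => by simp⟩
    | add x y _ _ hx hy =>
      obtain ⟨b, hb⟩ := hx
      obtain ⟨c, hc⟩ := hy
      exact ⟨b + c, fun z => by
        rw [MulOpposite.op_add, MulOpposite.op_add, add_smul, add_smul, map_add, hb, hc]⟩
    | smul k x _ hx =>
      obtain ⟨b, hb⟩ := hx
      refine ⟨k • b, fun z => ?_⟩
      -- The module structures do not by themselves relate complex scalars in B to those of Z;
      -- pairing with w gives k⟨w, z⟩c on both sides.
      have hk : ∀ c : B, z <• (k • c) = (k • z) <• c := fun c => ext_inner (B := B) fun w => by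
        rw [inner_op_smul_right, inner_op_smul_right, RightHilbertModule.inner_smul_right,
          smul_mul_assoc,
          mul_smul_comm]
      rw [hk, hk, hb]
  obtain ⟨b, hb⟩ := key 1 I.one_mem_span_inner
  exact ⟨b, fun z => by simpa using hb z⟩

/-- Mirror image of `exists_op_smul_eq_act`, needed for surjectivity of φ. Here commutativity of B
gives (x·b)·⟨y, z⟩ = (x·⟨y, z⟩)·b, so _A⟨x·b, y⟩ acts as _A⟨x, y⟩ followed by b. -/
lemma exists_act_eq_op_smul (b : B) : ∃ a : A, ∀ z : Z, I.act a z = z <• b := by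
  have key : ∀ d ∈ Submodule.span ℂ {a : A | ∃ x y : Z, I.leftInner x y = a},
      ∃ a : A, ∀ z : Z, I.act a z = I.act d z <• b := by
    intro d hd
    induction hd using Submodule.span_induction with
    | mem d hd =>
      obtain ⟨x, y, rfl⟩ := hd
      refine ⟨I.leftInner (x <• b) y, fun z => ?_⟩
      rw [I.leftInner_act, I.leftInner_act, smul_smul, smul_smul, ← MulOpposite.op_mul,
        ← MulOpposite.op_mul, mul_comm]
    | zero => exact ⟨0, fun z => by simp⟩
    | add x y _ _ hx hy =>
      obtain ⟨a, ha⟩ := hx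
      obtain ⟨c, hc⟩ := hy
      exact ⟨a + c, fun z => by
        rw [map_add, map_add, add_apply, add_apply, smul_add, ha, hc]⟩
    | smul k x _ hx =>
      obtain ⟨a, ha⟩ := hx
      have := RightHilbertModule.smulCommClass B Z
      exact ⟨k • a, fun z => by
        rw [map_smul, map_smul, smul_apply, smul_apply, ha, smul_comm]⟩
  obtain ⟨a, ha⟩ := key 1 I.one_mem_span_leftInner
  exact ⟨a, fun z => by simpa using ha z⟩

/-- Over commutative C*-algebras an imprimitivity bimodule comes with an isomorphism between them
that relates the left and the right action. -/
lemma exists_starAlgEquiv : ∃ φ : A ≃⋆ₐ[ℂ] B, ∀ (a : A) (z : Z), I.act a z = z <• φ a := by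
  -- The chosen value is unique by faithfulness of the right action, so each homomorphism law
  -- reduces to an identity of operators on Z.
  choose f hf using I.exists_op_smul_eq_act
  let φ : A →⋆ₐ[ℂ] B :=
    { toFun := f
      map_one' := I.eq_of_op_smul_eq fun z => by rw [← hf]; simp
      map_zero' := I.eq_of_op_smul_eq fun z => by rw [← hf]; simp
      -- Turning a left action into a right one reverses products; commutativity of A undoes the
      -- reversal.
      map_mul' := fun a b => I.eq_of_op_smul_eq fun z => by
        rw [← hf, mul_comm, map_mul, mul_apply_eq_comp, hf, hf a, smul_smul,
          ← MulOpposite.op_mul]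
      map_add' := fun a b => I.eq_of_op_smul_eq fun z => by
        rw [← hf, map_add, add_apply, hf, hf, MulOpposite.op_add, add_smul]
      commutes' := fun c => I.eq_of_op_smul_eq fun z => by
        rw [← hf, AlgHom.commutes]
        refine ext_inner (B := B) fun w => ?_
        rw [inner_op_smul_right, Algebra.algebraMap_eq_smul_one, Algebra.algebraMap_eq_smul_one,
          mul_smul_comm, mul_one, smul_apply, one_apply_eq_self,
          RightHilbertModule.inner_smul_right]
      -- ⟨w, a⋆·z⟩ = ⟨a·w, z⟩ = f(a)⋆⟨w, z⟩, and f(a)⋆ moves to the right since B is commutative.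
      map_star' := fun a => I.eq_of_op_smul_eq fun z => ext_inner (B := B) fun w => by
        rw [← hf, ← I.adjoint, hf, inner_op_smul_left, inner_op_smul_right, mul_comm] }
  -- Injectivity is faithfulness of the left action; surjectivity realizes each right multiplication
  -- as a left action.
  refine ⟨StarAlgEquiv.ofBijective φ ⟨fun a b h => I.eq_of_act_eq fun z => ?_, fun b => ?_⟩, hf⟩
  · rw [hf, hf]
    exact congrArg (fun c : B => z <• c) h
  · obtain ⟨a, ha⟩ := I.exists_act_eq_op_smul b
    exact ⟨a, I.eq_of_op_smul_eq fun z => by rw [← ha, hf]; rfl⟩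

end ImprimitivityBimodule

/-- The two covariance rules of δ, applied to φ⁻¹(b)·z = z·b, show that φ(α_g(φ⁻¹(b))) and β_g(b)
act alike on δ(g)z. The cocycle condition is just φ(1) = 1. -/
lemma TwistedSystem.MoritaEquivalent.conjugate_ofAction {G : Type w} [Group G] {A : Type u}
    {B : Type v} [CommCStarAlgebra A] [CommCStarAlgebra B] {α : G →* (A ≃⋆ₐ[ℂ] A)}
    {β : G →* (B ≃⋆ₐ[ℂ] B)} (h : MoritaEquivalent (.ofAction α) (.ofAction β)) :
    Conjugate (.ofAction α) (.ofAction β) := by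
  obtain ⟨Z, _, _, _, _, I, ⟨C⟩⟩ := h
  obtain ⟨φ, hφ⟩ := I.exists_starAlgEquiv
  refine ⟨φ, fun g b => I.eq_of_op_smul_eq fun z => ?_, fun g h => (map_one φ).symm⟩
  -- The comparison is available only on the range of δ(g), which is all of Z.
  obtain ⟨z, rfl⟩ := (C.δ g).surjective z
  rw [← hφ, ← C.δ_act, ← C.δ_op_smul, hφ, StarAlgEquiv.apply_symm_apply]

/-! ### From a conjugacy to an equivariant imprimitivity bimodule -/

/-- A C*-algebra as a right Hilbert module over itself. -/
@[reducible] noncomputable def RightHilbertModule.self (B : Type*) [CStarAlgebra B] : RightHilbertModule B B where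
  inner x y := star x * y
  inner_add_right x y z := mul_add _ _ _
  inner_smul_right x y c := mul_smul_comm _ _ _
  inner_op_smul_right x y b := (mul_assoc _ _ _).symm
  star_inner x y := by simp
  inner_self_nonneg x := ⟨x, rfl⟩
  norm_sq_eq x := by rw [sq]; exact CStarRing.norm_star_mul_self.symm
  complete := inferInstance

section SelfBimodule

variable {A B : Type*} [CStarAlgebra A] [CStarAlgebra B]

attribute [local instance] RightHilbertModule.self

lemma RightHilbertModule.self_inner (x y : B) : ⟪x, y⟫_B = star x * y := rfl

/-- The imprimitivity bimodule `B` given by an isomorphism `A ≃ B`. -/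
@[reducible] noncomputable def ImprimitivityBimodule.ofStarAlgEquiv (φ : A ≃⋆ₐ[ℂ] B) :
    ImprimitivityBimodule A B B where
  act := AlgHom.ofLinearMap
    ((ContinuousLinearMap.mul ℂ B).toLinearMap.comp φ.toAlgEquiv.toLinearEquiv.toLinearMap)
    (by ext; simp) (fun a b => by ext; simp [mul_assoc])
  adjoint a x y := by
    simp [RightHilbertModule.self_inner, mul_assoc, map_star]
  leftInner x y := φ.symm (x * star y)
  leftInner_add_left x y z := by rw [add_mul, map_add]
  leftInner_smul_left c x y := by rw [smul_mul_assoc, map_smul]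
  leftInner_act_left a x y := by simp [mul_assoc]
  star_leftInner x y := by rw [← map_star, star_mul, star_star]
  leftInner_self_nonneg x := ⟨φ.symm (star x), by rw [← map_star, ← map_mul, star_star]⟩
  leftInner_definite x h := by
    rwa [EmbeddingLike.map_eq_zero_iff, CStarRing.mul_star_self_eq_zero_iff] at h
  leftInner_op_smul x y b := by simp [mul_assoc]
  leftInner_act x y z := by simp [RightHilbertModule.self_inner, mul_assoc]
  full_right := by
    have : {b : B | ∃ x y : B, ⟪x, y⟫_B = b} = Set.univ :=
      Set.eq_univ_of_forall fun b => ⟨1, b, by simp [RightHilbertModule.self_inner]⟩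
    rw [this, Submodule.span_univ, ← top_le_iff]
    exact Submodule.le_topologicalClosure _
  full_left := by
    have : {a : A | ∃ x y : B, φ.symm (x * star y) = a} = Set.univ :=
      Set.eq_univ_of_forall fun a => ⟨φ a, 1, by simp⟩
    rw [this, Submodule.span_univ, ← top_le_iff]
    exact Submodule.le_topologicalClosure _

/-- Injective *-homomorphisms of C*-algebras are isometric. -/
lemma StarAlgEquiv.continuous_of_cstar (φ : A ≃⋆ₐ[ℂ] B) : Continuous φ :=
  (NonUnitalStarAlgHom.isometry φ φ.injective).continuous

/-- A *-isomorphism as a continuous linear equivalence. -/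
@[reducible] noncomputable def StarAlgEquiv.toCLE (φ : A ≃⋆ₐ[ℂ] B) : A ≃L[ℂ] B where
  toLinearEquiv := φ.toAlgEquiv.toLinearEquiv
  continuous_toFun := φ.continuous_of_cstar
  continuous_invFun := φ.symm.continuous_of_cstar

/-- The bimodule is B with A acting through φ, and δ = β. Covariance on the left is φ ∘ α_g = β_g ∘
φ; the remaining rules say that β is an action by *-automorphisms. Commutativity plays no role in
this direction. -/
lemma TwistedSystem.Conjugate.moritaEquivalent_ofAction {G : Type v} [Group G] {A B : Type u}
    [CStarAlgebra A] [CStarAlgebra B] {α : G →* (A ≃⋆ₐ[ℂ] A)} {β : G →* (B ≃⋆ₐ[ℂ] B)}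
    (h : Conjugate (.ofAction α) (.ofAction β)) :
    MoritaEquivalent (.ofAction α) (.ofAction β) := by
  obtain ⟨φ, hφ, -⟩ := h
  refine ⟨B, inferInstance, inferInstance, inferInstance, inferInstance, .ofStarAlgEquiv φ,
    ⟨{ δ := fun g => (β g).toCLE, δ_act := ?_, δ_op_smul := ?_, δ_δ := ?_, inner_δ := ?_ }⟩⟩
  · intro g a z
    have h := hφ g (φ a)
    rw [StarAlgEquiv.symm_apply_apply] at h
    change β g (φ a * z) = φ (α g a) * β g z
    rw [map_mul]
    exact congrArg (· * β g z) h
  · intro g z b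
    exact map_mul (β g) z b
  · intro g h z
    change β g (β h z) = (φ 1 * β (g * h) z) * star 1
    simp
  · intro g x y
    change star (β g x) * β g y = β g (star x * y)
    rw [map_mul, map_star]

end SelfBimodule

/-! ### Transport of Hilbert modules and representations along an isomorphism -/

section Transport

variable {A B X : Type*} [CStarAlgebra A] [CStarAlgebra B] [NormedAddCommGroup X]
  [NormedSpace ℂ X] [Module Aᵐᵒᵖ X] [RightHilbertModule A X]

/-- The right `B`-module structure on a right `A`-module given by an isomorphism `A ≃ B`. -/
@[reducible] noncomputable def StarAlgEquiv.transportModule (X : Type*) [AddCommGroup X] [Module Aᵐᵒᵖ X]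
    (φ : A ≃⋆ₐ[ℂ] B) : Module Bᵐᵒᵖ X :=
  Module.compHom X (φ.symm.toAlgEquiv.toRingEquiv.toRingHom.op)

/-- The Hilbert `B`-module structure on a Hilbert `A`-module given by an isomorphism `A ≃ B`. -/
@[reducible] noncomputable def StarAlgEquiv.transportHilbertModule (X : Type*) [NormedAddCommGroup X]
    [NormedSpace ℂ X] [Module Aᵐᵒᵖ X] [RightHilbertModule A X] (φ : A ≃⋆ₐ[ℂ] B) :
    letI := φ.transportModule X
    RightHilbertModule B X :=
  letI := φ.transportModule X
  { inner := fun x y => φ ⟪x, y⟫_A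
    inner_add_right := fun x y z => by rw [RightHilbertModule.inner_add_right, map_add]
    inner_smul_right := fun x y c => by rw [RightHilbertModule.inner_smul_right, map_smul]
    inner_op_smul_right := fun x y b => by
      change φ ⟪x, y <• φ.symm b⟫_A = _
      rw [RightHilbertModule.inner_op_smul_right, map_mul, StarAlgEquiv.apply_symm_apply]
    star_inner := fun x y => by rw [← map_star, RightHilbertModule.star_inner]
    inner_self_nonneg := fun x => by
      obtain ⟨a, ha⟩ := RightHilbertModule.inner_self_nonneg (B := A) x
      exact ⟨φ a, by rw [ha, map_mul, map_star]⟩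
    norm_sq_eq := fun x => by
      -- Since φ is isometric, the original norm of X also belongs to the B-valued inner product;
      -- completeness carries over and vectors keep their norms.
      rw [NonUnitalStarAlgHom.norm_map φ φ.injective]
      exact RightHilbertModule.norm_sq_eq x
    complete := RightHilbertModule.complete A }

/-- Transport of a representation along an isomorphism. -/
@[reducible] noncomputable def HilbertRep.transport (φ : A ≃⋆ₐ[ℂ] B) (κ : HilbertRep A A X) :
    letI := φ.transportModule X
    letI := φ.transportHilbertModule X
    HilbertRep B B X :=
  letI := φ.transportModule X
  letI := φ.transportHilbertModule X
  { act := κ.act.comp (φ.symm : B →ₐ[ℂ] A)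
    adjoint := fun b x y => by
      change φ ⟪κ.act (φ.symm b) x, y⟫_A = φ ⟪x, κ.act (φ.symm (star b)) y⟫_A
      rw [κ.adjoint, map_star φ.symm] }

/-- Transport of an equivariant representation along a conjugacy. -/
@[reducible] noncomputable def EquivariantRep.transport {G : Type*} [Group G] {S : TwistedSystem G A}
    {T : TwistedSystem G B} (φ : A ≃⋆ₐ[ℂ] B) (hα : ∀ g b, T.α g b = φ (S.α g (φ.symm b)))
    (hσ : ∀ g h, (T.σ g h : B) = φ (S.σ g h : A)) (π : EquivariantRep S X) :
    letI := φ.transportModule X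
    letI := φ.transportHilbertModule X
    EquivariantRep T X :=
  letI := φ.transportModule X
  letI := φ.transportHilbertModule X
  { ρ := π.ρ.transport φ
    v := π.v
    ρ_α := fun g b x => by
      change π.ρ.act (φ.symm (T.α g b)) x = π.v g (π.ρ.act (φ.symm b) _)
      rw [hα, StarAlgEquiv.symm_apply_apply, π.ρ_α]
    v_v := fun g h x => by
      change _ = π.ρ.act (φ.symm (T.σ g h : B)) (π.v (g * h) x) <• φ.symm (star (T.σ g h : B))
      rw [hσ, ← map_star, StarAlgEquiv.symm_apply_apply, StarAlgEquiv.symm_apply_apply, π.v_v]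
    inner_v := fun g x y => by
      change T.α g (φ ⟪x, y⟫_A) = φ ⟪π.v g x, π.v g y⟫_A
      rw [hα, StarAlgEquiv.symm_apply_apply, π.inner_v]
    v_op_smul := fun g x b => by
      change π.v g (x <• φ.symm b) = π.v g x <• φ.symm (T.α g b)
      rw [hα, StarAlgEquiv.symm_apply_apply, π.v_op_smul] }

end Transport

/-! ### Isometric isomorphism of Fourier–Stieltjes algebras -/

namespace TwistedSystem

variable {G : Type v} {A B : Type u} [CStarAlgebra A] [CStarAlgebra B]

/-- The isomorphism `L(Σ) ≃ L(Θ)`, `T ↦ φ ∘ T ∘ φ⁻¹`, given by an isomorphism `φ : A ≃ B`. -/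
noncomputable def lAlgConj (G : Type v) (φ : A ≃⋆ₐ[ℂ] B) : LAlg G A ≃ₐ[ℂ] LAlg G B :=
  AlgEquiv.piCongrRight fun _ => φ.toAlgEquiv.toLinearEquiv.conjAlgEquiv ℂ

lemma lAlgConj_symm (φ : A ≃⋆ₐ[ℂ] B) (T : LAlg G B) :
    (lAlgConj G φ).symm T = lAlgConj G φ.symm T := rfl

variable [Group G] {S : TwistedSystem G A} {T : TwistedSystem G B}

/-- The same space and vectors serve after transport, so r is unchanged. A and B share a universe,
which keeps X admissible for B. -/
lemma HasDecomposition.conj (φ : A ≃⋆ₐ[ℂ] B) (hα : ∀ g b, T.α g b = φ (S.α g (φ.symm b)))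
    (hσ : ∀ g h, (T.σ g h : B) = φ (S.σ g h : A)) {F : LAlg G A} {r : ℝ}
    (h : S.HasDecomposition F r) : T.HasDecomposition (lAlgConj G φ F) r := by
  obtain ⟨X, _, _, _, _, π, x, y, rfl, hr⟩ := h
  let _ := φ.transportModule X
  let _ := φ.transportHilbertModule X
  -- The transported coefficient is b ↦ φ⟨x, ρ(φ⁻¹(b))v(g)y⟩, which is φ ∘ T_g ∘ φ⁻¹ by definition.
  exact ⟨X, inferInstance, inferInstance, inferInstance, inferInstance, π.transport φ hα hσ, x, y,
    rfl, hr⟩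

lemma hasDecomposition_lAlgConj_iff (φ : A ≃⋆ₐ[ℂ] B)
    (hα : ∀ g b, T.α g b = φ (S.α g (φ.symm b)))
    (hσ : ∀ g h, (T.σ g h : B) = φ (S.σ g h : A)) (F : LAlg G A) (r : ℝ) :
    T.HasDecomposition (lAlgConj G φ F) r ↔ S.HasDecomposition F r := by
  refine ⟨fun h => ?_, fun h => h.conj φ hα hσ⟩
  -- The converse is the forward direction for φ⁻¹ with the systems interchanged.
  have := h.conj (T := S) φ.symm (fun g a => by simp [hα]) (fun g h => by simp [hσ])
  rwa [← lAlgConj_symm, AlgEquiv.symm_apply_apply] at this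

/-- Conjugate systems have isometrically isomorphic Fourier-Stieltjes algebras. -/
lemma Conjugate.exists_fourierStieltjes_algEquiv (h : S.Conjugate T) :
    ∃ Ψ : S.fourierStieltjes ≃ₐ[ℂ] T.fourierStieltjes, ∀ F, ‖Ψ F‖ = ‖F‖ := by
  obtain ⟨φ, hα, hσ⟩ := h
  have hmap : S.fourierStieltjes.map (lAlgConj G φ).toAlgHom = T.fourierStieltjes := by
    ext F
    obtain ⟨F, rfl⟩ := (lAlgConj G φ).surjective F
    constructor
    · rintro ⟨F', ⟨r, hr⟩, hF⟩
      exact ⟨r, hF ▸ hr.conj φ hα hσ⟩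
    · rintro ⟨r, hr⟩
      exact ⟨F, ⟨r, (hasDecomposition_lAlgConj_iff φ hα hσ F r).mp hr⟩, rfl⟩
  refine ⟨((lAlgConj G φ).subalgebraMap _).trans (Subalgebra.equivOfEq _ _ hmap), fun F => ?_⟩
  -- Both norms are infima of the same set of reals.
  exact congrArg sInf (Set.ext fun r => hasDecomposition_lAlgConj_iff φ hα hσ F r)

end TwistedSystem

/-! ### Morita equivalence, conjugacy and Fourier–Stieltjes algebras -/

theorem mainTheorem7 {G : Type v} [Group G] {A B : Type u} [CommCStarAlgebra A]
    [CommCStarAlgebra B] (α : G →* (A ≃⋆ₐ[ℂ] A)) (β : G →* (B ≃⋆ₐ[ℂ] B)) :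
    (TwistedSystem.MoritaEquivalent (.ofAction α) (.ofAction β) ↔
      TwistedSystem.Conjugate (.ofAction α) (.ofAction β)) ∧
    (TwistedSystem.MoritaEquivalent (.ofAction α) (.ofAction β) →
      ∃ Ψ : (TwistedSystem.ofAction α).fourierStieltjes ≃ₐ[ℂ]
          (TwistedSystem.ofAction β).fourierStieltjes,
        ∀ T, ‖Ψ T‖ = ‖T‖) :=
  ⟨⟨fun h => h.conjugate_ofAction, fun h => h.moritaEquivalent_ofAction⟩,
    fun h => h.conjugate_ofAction.exists_fourierStieltjes_algEquiv⟩
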